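/- Let $\mathcal X,\mathcal Y$ be finite alphabets and let $p_{XY}$ be a probability mass function on $\mathcal X\times\mathcal Y$ that is $\mathcal X$-confusable: for every $x_1,x_2\in\mathcal X$ there is $y\in\mathcal Y$ with $p_{XY}(x_1,y)>0$ and $p_{XY}(x_2,y)>0$. Let $(X^n,Y^n)$ denote $n$ independent copies of $(X,Y)\sim p_{XY}$, and let $H(X)$ be the Shannon entropy of $X$ in bits. Let $R_1<H(X)$. (a) There is a constant $K>0$, depending only on $p_{XY}$ and $R_1$, such that the following holds for all integers $n\ge 1$ and $d\ge 1$. Suppose $X^n$ is encoded by an arbitrary map into a binary codeword $C=C(X^n)$ of length $k\le nR_1$. For each $i\in\{1,\dots,n\}$ let $\mathcal I_i\subseteq\{1,\dots,k\}$ be a set of positions (deterministic, or random and independent of $(X^n,Y^n)$) with $|\mathcal I_i|\le d$ (almost surely), and let $\hat X_i$ be any (possibly randomized) estimator of $X_i$ based on $\mathcal I_i$, the codeword bits $C_{\mathcal I_i}$ at these positions, and the whole uncompressed sequence $Y^n$. Then $$\max_{1\le i\le n}\Pr\bigl[\hat X_i(C_{\mathcal I_i},Y^n)\ne X_i\bigr]\;\ge\;2^{-Kd}.$$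 (b) Consequently, for no $R_2\in\mathbb R$ is the rate pair $(R_1,R_2)$ achievable with strong locality. That is, there are no sequences (in $n$) of separate encoders of $X^n$ and $Y^n$ into binary codewords of lengths $k_1(n),k_2(n)$ with $\limsup_n k_j(n)/n\le R_j$ for $j=1,2$, together with local decoders which, for each $i\in\{1,\dots,n\}$, probe a non-adaptively chosen set (possibly random, independent of the sources) of at most $d$ bits of the two codewords, with $d$ independent of $n$, and output an estimate $(\hat X_i,\hat Y_i)$, such that $\max_{1\le i\le n}\Pr[(\hat X_i,\hat Y_i)\ne(X_i,Y_i)]\to 0$ as $n\to\infty$. -/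

import Mathlib

open Filter Topology

noncomputable section

namespace LocalCompression

variable {α β : Type*} [Fintype α] [Fintype β]

/-- The first marginal `p_X` of a joint probability mass function `p_XY`. -/
def marginalX (p : PMF (α × β)) (x : α) : ℝ := ∑ y, (p (x, y)).toReal

/-- Shannon entropy `H(X)` in bits (with the convention `0 log 0 = 0`). -/
def entropyX (p : PMF (α × β)) : ℝ :=
  -∑ x, marginalX p x * Real.logb 2 (marginalX p x)

/-- The source is `X`-confusable: any two letters `x₁, x₂` share a letter `y` with which both
have positive joint probability. -/
def IsConfusable (p : PMF (α × β)) : Prop :=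
  ∀ x₁ x₂ : α, ∃ y : β, 0 < p (x₁, y) ∧ 0 < p (x₂, y)

/-- `Pr[X^n = x, Y^n = y]` for `n` independent copies of `(X, Y) ∼ p`. -/
def iidProb (p : PMF (α × β)) {n : ℕ} (x : Fin n → α) (y : Fin n → β) : ℝ :=
  ∏ j, (p (x j, y j)).toReal

/-- A (non-adaptive, possibly randomized) local decoder for sequences of length `n`. The codeword
bits are indexed by `κ`, the side information lies in `σ`, and the quantity to be estimated
in `τ`. Given the index `i`, it draws a set `I` of positions with law `probe i` (independent of
the sources), reads the bits in `I`, and outputs an estimate that depends only on `i`, `I`, the bits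
read and the side information, and possibly on independent randomness; `estimate` is the
conditional law of the output. Deterministic decoders are those with `PMF.pure` laws. -/
structure LocalDecoder (n : ℕ) (κ σ τ : Type*) where
  /-- law of the set of probed positions -/
  probe : Fin n → PMF (Finset κ)
  /-- law of the estimate, given the probed set, the bits read and the side information -/
  estimate : Fin n → (I : Finset κ) → (I → Bool) → σ → PMF τ

/-- For every index `i`, the decoder almost surely probes at most `d` positions. -/
def LocalDecoder.ProbesAtMost {n : ℕ} {κ σ τ : Type*} (D : LocalDecoder n κ σ τ) (d : ℕ) : Prop :=
  ∀ i, ∀ I ∈ (D.probe i).support, I.card ≤ d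

/-- Probability that the output of the local decoder at index `i` differs from
`target (X_i) (Y_i)`, when the codeword is `codeword X^n Y^n`, the side information is
`side X^n Y^n`, and `(X^n, Y^n)` are `n` independent copies of `(X, Y) ∼ p`. -/
def errorProb (p : PMF (α × β)) {n : ℕ} {κ σ τ : Type*} [Fintype κ]
    (codeword : (Fin n → α) → (Fin n → β) → κ → Bool)
    (side : (Fin n → α) → (Fin n → β) → σ) (target : α → β → τ)
    (D : LocalDecoder n κ σ τ) (i : Fin n) : ℝ :=
  ∑ x : Fin n → α, ∑ y : Fin n → β, iidProb p x y *
    ∑ I : Finset κ, (D.probe i I).toReal *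
      (1 - (D.estimate i I (fun j => codeword x y j) (side x y) (target (x i) (y i))).toReal)

/-- `max_i Pr[X̂_i(C_{I_i}, Y^n) ≠ X_i]`: worst-case error when `X^n` is encoded by `enc` and the
local decoder estimates `X_i` from the probed bits and the whole uncompressed `Y^n`. -/
def worstErrorX (p : PMF (α × β)) {n k : ℕ} (enc : (Fin n → α) → Fin k → Bool)
    (D : LocalDecoder n (Fin k) (Fin n → β) α) : ℝ :=
  ⨆ i : Fin n, errorProb p (fun x _ => enc x) (fun _ y => y) (fun a _ => a) D i

/-- `max_i Pr[(X̂_i, Ŷ_i) ≠ (X_i, Y_i)]`: worst-case error when `X^n` and `Y^n` are separately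
encoded by `enc₁` and `enc₂` and the local decoder estimates `(X_i, Y_i)` from the bits that it
probes in the two codewords, without further side information. -/
def worstErrorXY (p : PMF (α × β)) {n k₁ k₂ : ℕ} (enc₁ : (Fin n → α) → Fin k₁ → Bool)
    (enc₂ : (Fin n → β) → Fin k₂ → Bool)
    (D : LocalDecoder n (Fin k₁ ⊕ Fin k₂) Unit (α × β)) : ℝ :=
  ⨆ i : Fin n, errorProb p (fun x y => Sum.elim (enc₁ x) (enc₂ y)) (fun _ _ => ())
    (fun a b => (a, b)) D i

/-- The rate pair `(R₁, R₂)` is achievable with strong locality: there are separate encoders into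
codewords of `k₁ n` and `k₂ n` bits, of asymptotic rates at most `R₁` and `R₂`, and local decoders
which probe a number of bits bounded independently of `n` and whose worst-case error probability
tends to zero. -/
def AchievableWithStrongLocality (p : PMF (α × β)) (R₁ R₂ : ℝ) : Prop :=
  ∃ (k₁ k₂ : ℕ → ℕ)
    (enc₁ : ∀ n, (Fin n → α) → Fin (k₁ n) → Bool)
    (enc₂ : ∀ n, (Fin n → β) → Fin (k₂ n) → Bool)
    (D : ∀ n, LocalDecoder n (Fin (k₁ n) ⊕ Fin (k₂ n)) Unit (α × β)) (d : ℕ),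
    (∀ ε > 0, ∀ᶠ n : ℕ in atTop, (k₁ n : ℝ) ≤ n * (R₁ + ε)) ∧
    (∀ ε > 0, ∀ᶠ n : ℕ in atTop, (k₂ n : ℝ) ≤ n * (R₂ + ε)) ∧
    (∀ n, (D n).ProbesAtMost d) ∧
    Tendsto (fun n => worstErrorXY p (enc₁ n) (enc₂ n) (D n)) atTop (𝓝 0)

end LocalCompression

end

namespace LocalCompression

/-! Two facts collide. Below entropy, the whole codeword leaves a constant uncertainty about some
letter `X_i`, and `i` can be chosen before the probed positions are known
(`exists_prediction_error_lower_bound`). So for any `d` probed bits some value of these bits is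
compatible with two letters `a ≠ b`, each jointly with probability of order `2^(-d)`
(`exists_two_likely_letters`).

Confusability says that `Y^n` cannot reliably separate two such events. Let `X'` be a second input
drawn from the posterior of `X` given `Y`. The law of `(X, X')` is a strictly positive coupling of
`p_X` with itself, hence reverse hypercontractive (`exists_reverse_hypercontractive`), and this
tensorizes with an exponent `r` independent of `n` (`reverse_hypercontractive_pi`). Sets `A`, `B` of
sequences therefore satisfy `Pr[X^n ∈ A, X'^n ∈ B] ≥ (Pr[A] Pr[B])^r`. Applied to the two events,
this is exponential in `d` only, and it bounds the error of any estimator from below, since for the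
same bits and the same `Y^n` the estimator cannot favour both `a` and `b` (`confusion_le_error`).

For separate encoders, giving the decoder all of `Y^n` only helps: it can then compute every bit of
the second codeword itself. -/

/-- A quadratic strengthening of Bernoulli's inequality, for large even exponents. -/
theorem one_add_mul_add_mul_sq_le_pow {M s : ℝ} {m : ℕ} (hM : 0 < M) (hm : 2 * M ≤ m)
    (hs : -1 ≤ s) (hsM : -1 ≤ 2 * M * s) :
    1 + (2 * m : ℕ) * s + M * (2 * m : ℕ) * s ^ 2 ≤ (1 + s) ^ (2 * m) := by
  have hm0 : (0 : ℝ) < m := by linarith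
  push_cast
  by_cases h : 0 ≤ 1 + m * s
  · have hb : 1 + m * s ≤ (1 + s) ^ m := one_add_mul_le_pow (by linarith) m
    have h2 : (1 + m * s) ^ 2 ≤ (1 + s) ^ (2 * m) := by
      rw [mul_comm 2 m, pow_mul]
      exact pow_le_pow_left₀ h hb 2
    have h3 : 2 * M * (m * s ^ 2) ≤ m * (m * s ^ 2) :=
      mul_le_mul_of_nonneg_right hm (by positivity)
    nlinarith
  -- Here `1 + m * s < 0`, and the left side is `(1 + m * s) + m * s * (1 + 2 * M * s)`, both of
  -- whose summands are at most zero.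
  · push Not at h
    have h0 : (0 : ℝ) ≤ (1 + s) ^ (2 * m) := pow_nonneg (by linarith) _
    have hs0 : s < 0 := by
      by_contra hc
      push Not at hc
      have := mul_nonneg hm0.le hc
      linarith
    have h3 : 0 ≤ (2 * M * s + 1) * (m * -s) :=
      mul_nonneg (by linarith) (mul_nonneg hm0.le (by linarith))
    nlinarith

/-! ### Reverse hypercontractivity of positive couplings -/

section Coupling

variable {α : Type*} [Fintype α] {μ : α → ℝ} {W : α → α → ℝ} {w : ℝ}

/-- The perturbative case of the reverse inequality, with both means normalized to 1. Correlation
can lower the mean of `u * v` by at most half the sum of the variances. Since the coupling dominates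
`w` times the product law, `u * v - 1` has second moment at least `w` times that sum. A large even
power weights the second moment enough to cancel the loss. -/
theorem coupling_moment_of_near_one (hμ : ∀ x, 0 ≤ μ x) (hμ1 : ∑ x, μ x = 1)
    (hr : ∀ x, ∑ x', W x x' = μ x) (hc : ∀ x', ∑ x, W x x' = μ x')
    (hw : 0 < w) (hw1 : w ≤ 1) (hW : ∀ x x', w * (μ x * μ x') ≤ W x x')
    {m : ℕ} (hm : 1 ≤ w * m) {u v : α → ℝ}
    (hu : ∀ x, 1 - w / 2 ≤ u x) (hv : ∀ x, 1 - w / 2 ≤ v x)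
    (hu1 : ∑ x, μ x * u x = 1) (hv1 : ∑ x, μ x * v x = 1) :
    1 ≤ ∑ x, ∑ x', W x x' * (u x ^ (2 * m) * v x' ^ (2 * m)) := by
  have hW0 : ∀ x x', 0 ≤ W x x' := fun x x' =>
    (mul_nonneg hw.le (mul_nonneg (hμ x) (hμ x'))).trans (hW x x')
  have hsum : ∑ x, ∑ x', W x x' = 1 := by simp_rw [hr, hμ1]
  set a := ∑ x, μ x * (u x - 1) ^ 2 with ha
  set b := ∑ x, μ x * (v x - 1) ^ 2 with hb
  have ha0 : 0 ≤ a := Finset.sum_nonneg fun x _ => mul_nonneg (hμ x) (sq_nonneg _)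
  have hb0 : 0 ≤ b := Finset.sum_nonneg fun x _ => mul_nonneg (hμ x) (sq_nonneg _)
  have hl : ∀ φ : α → ℝ, ∑ x, ∑ x', W x x' * φ x = ∑ x, μ x * φ x := fun φ => by
    simp_rw [← Finset.sum_mul, hr]
  have hrr : ∀ φ : α → ℝ, ∑ x, ∑ x', W x x' * φ x' = ∑ x, μ x * φ x := fun φ => by
    rw [Finset.sum_comm]
    simp_rw [← Finset.sum_mul, hc]
  have hu2 : ∑ x, μ x * u x ^ 2 = 1 + a := by
    have : ∀ x, μ x * (u x - 1) ^ 2 = μ x * u x ^ 2 - 2 * (μ x * u x) + μ x := fun x => by ring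
    simp_rw [ha, this, Finset.sum_add_distrib, Finset.sum_sub_distrib, ← Finset.mul_sum, hu1, hμ1]
    ring
  have hv2 : ∑ x, μ x * v x ^ 2 = 1 + b := by
    have : ∀ x, μ x * (v x - 1) ^ 2 = μ x * v x ^ 2 - 2 * (μ x * v x) + μ x := fun x => by ring
    simp_rw [hb, this, Finset.sum_add_distrib, Finset.sum_sub_distrib, ← Finset.mul_sum, hv1, hμ1]
    ring
  -- first moment
  have h1 : -(a + b) / 2 ≤ ∑ x, ∑ x', W x x' * (u x * v x' - 1) := by
    have key : ∑ x, ∑ x', W x x' * (-((u x - 1) ^ 2 + (v x' - 1) ^ 2) / 2 + (u x - 1) + (v x' - 1))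
        ≤ ∑ x, ∑ x', W x x' * (u x * v x' - 1) :=
      Finset.sum_le_sum fun x _ => Finset.sum_le_sum fun x' _ =>
        mul_le_mul_of_nonneg_left (by nlinarith [sq_nonneg (u x - 1 + (v x' - 1))]) (hW0 x x')
    have e : ∀ x x', W x x' * (-((u x - 1) ^ 2 + (v x' - 1) ^ 2) / 2 + (u x - 1) + (v x' - 1))
        = W x x' * (-(u x - 1) ^ 2 / 2 + u x - 1) + W x x' * (-(v x' - 1) ^ 2 / 2 + v x' - 1) :=
      fun x x' => by ring
    simp_rw [e, Finset.sum_add_distrib] at key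
    rw [hl (fun x => -(u x - 1) ^ 2 / 2 + u x - 1),
      hrr (fun x => -(v x - 1) ^ 2 / 2 + v x - 1)] at key
    have e2 : ∀ x, μ x * (-(u x - 1) ^ 2 / 2 + u x - 1)
        = -(1 / 2) * (μ x * (u x - 1) ^ 2) + μ x * u x - μ x := fun x => by ring
    have e3 : ∀ x, μ x * (-(v x - 1) ^ 2 / 2 + v x - 1)
        = -(1 / 2) * (μ x * (v x - 1) ^ 2) + μ x * v x - μ x := fun x => by ring
    simp_rw [e2, e3, Finset.sum_sub_distrib, Finset.sum_add_distrib,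
      ← Finset.mul_sum, hu1, hv1, hμ1, ← ha, ← hb] at key
    linarith
  -- second moment
  have h2 : w * (a + b) ≤ ∑ x, ∑ x', W x x' * (u x * v x' - 1) ^ 2 := by
    have key : ∑ x, ∑ x', w * (μ x * μ x') * (u x * v x' - 1) ^ 2
        ≤ ∑ x, ∑ x', W x x' * (u x * v x' - 1) ^ 2 :=
      Finset.sum_le_sum fun x _ => Finset.sum_le_sum fun x' _ =>
        mul_le_mul_of_nonneg_right (hW x x') (sq_nonneg _)
    have e : ∀ x x', w * (μ x * μ x') * (u x * v x' - 1) ^ 2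
        = w * ((μ x * u x ^ 2) * (μ x' * v x' ^ 2)) - 2 * w * ((μ x * u x) * (μ x' * v x'))
          + w * (μ x * μ x') := fun x x' => by ring
    simp_rw [e, Finset.sum_add_distrib, Finset.sum_sub_distrib, ← Finset.mul_sum,
      ← Finset.sum_mul, hu1, hv1, hμ1, hu2, hv2] at key
    nlinarith [mul_nonneg hw.le (mul_nonneg ha0 hb0)]
  -- `M = 1 / (2 * w)` is the value at which the second-moment gain exactly balances the
  -- first-moment loss. The lower bounds on `u` and `v` give `u * v - 1 ≥ -w`, which is the range
  -- condition of the quadratic Bernoulli inequality for this `M`.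
  have hpt : ∀ x x', 1 + (2 * m : ℕ) * (u x * v x' - 1)
      + (1 / (2 * w)) * (2 * m : ℕ) * (u x * v x' - 1) ^ 2 ≤ u x ^ (2 * m) * v x' ^ (2 * m) := by
    intro x x'
    have h3 : (1 - w / 2) * (1 - w / 2) ≤ u x * v x' :=
      mul_le_mul (hu x) (hv x') (by linarith) (by linarith [hu x])
    have h4 : -w ≤ u x * v x' - 1 := by nlinarith
    have := one_add_mul_add_mul_sq_le_pow (M := 1 / (2 * w)) (s := u x * v x' - 1) (m := m)
      (by positivity) (by
        have : 2 * (1 / (2 * w)) = 1 / w := by field_simp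
        rw [this, div_le_iff₀ hw]; linarith) (by linarith) (by
        have : 2 * (1 / (2 * w)) * (u x * v x' - 1) = (u x * v x' - 1) / w := by field_simp
        rw [this, le_div_iff₀ hw]; linarith)
    rwa [add_sub_cancel, mul_pow] at this
  have key : ∑ x, ∑ x', W x x' * (1 + (2 * m : ℕ) * (u x * v x' - 1)
      + (1 / (2 * w)) * (2 * m : ℕ) * (u x * v x' - 1) ^ 2)
      ≤ ∑ x, ∑ x', W x x' * (u x ^ (2 * m) * v x' ^ (2 * m)) :=
    Finset.sum_le_sum fun x _ => Finset.sum_le_sum fun x' _ =>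
      mul_le_mul_of_nonneg_left (hpt x x') (hW0 x x')
  refine le_trans ?_ key
  have e : ∀ x x', W x x' * (1 + (2 * m : ℕ) * (u x * v x' - 1)
      + (1 / (2 * w)) * (2 * m : ℕ) * (u x * v x' - 1) ^ 2)
      = W x x' + (2 * m : ℕ) * (W x x' * (u x * v x' - 1))
        + (1 / (2 * w)) * (2 * m : ℕ) * (W x x' * (u x * v x' - 1) ^ 2) := fun x x' => by ring
  simp_rw [e, Finset.sum_add_distrib, ← Finset.mul_sum, hsum]
  have h5 : (2 * m : ℕ) * (-(a + b) / 2)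
      ≤ (2 * m : ℕ) * ∑ x, ∑ x', W x x' * (u x * v x' - 1) :=
    mul_le_mul_of_nonneg_left h1 (Nat.cast_nonneg _)
  have h6 : (1 / (2 * w)) * (2 * m : ℕ) * (w * (a + b))
      ≤ (1 / (2 * w)) * (2 * m : ℕ) * ∑ x, ∑ x', W x x' * (u x * v x' - 1) ^ 2 :=
    mul_le_mul_of_nonneg_left h2 (by positivity)
  have h7 : (1 / (2 * w)) * (2 * m : ℕ) * (w * (a + b)) = (2 * m : ℕ) * ((a + b) / 2) := by
    field_simp
  linarith

/-- A deficit `δ` at an atom of mass at least `w` must be compensated, as the mean is 1. -/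
theorem exists_one_add_le_of_lt (hμ : ∀ x, 0 ≤ μ x) (hμ1 : ∑ x, μ x = 1)
    {u : α → ℝ} (hu1 : ∑ x, μ x * u x = 1) (hμw : ∀ x, w ≤ μ x) (hw : 0 < w)
    {δ : ℝ} (hδ : 0 < δ) {x₀ : α} (hx : u x₀ < 1 - δ) : ∃ x, 1 + w * δ ≤ u x := by
  by_contra! h
  have h1 : μ x₀ * (1 + w * δ - u x₀) ≤ ∑ x, μ x * (1 + w * δ - u x) :=
    Finset.single_le_sum (f := fun x => μ x * (1 + w * δ - u x))
      (fun x _ => mul_nonneg (hμ x) (by linarith [h x])) (Finset.mem_univ x₀)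
  have h2 : ∑ x, μ x * (1 + w * δ - u x) = w * δ := by
    simp_rw [mul_sub, Finset.sum_sub_distrib, ← Finset.sum_mul, hu1, hμ1]
    ring
  have h3 : w * δ < μ x₀ * (1 + w * δ - u x₀) :=
    mul_lt_mul' (hμw x₀) (by nlinarith [mul_pos hw hδ]) hδ.le (hw.trans_le (hμw x₀))
  linarith

theorem exists_one_le (hμ1 : ∑ x, μ x = 1) (hμ : ∀ x, 0 < μ x) {u : α → ℝ}
    (hu1 : ∑ x, μ x * u x = 1) : ∃ x, 1 ≤ u x := by
  by_contra! h
  have hne : (Finset.univ : Finset α).Nonempty := by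
    by_contra hc
    rw [Finset.not_nonempty_iff_eq_empty] at hc
    simp [hc] at hμ1
  have := Finset.sum_lt_sum_of_nonempty hne
    (fun x _ => mul_lt_mul_of_pos_left (h x) (hμ x))
  simp [hμ1, hu1] at this

/-- The case far from constant: a single term suffices, because Bernoulli gives `w * (1 + w ^ 2 / 2)
^ (2 * m) ≥ w + w ^ 3 * m ≥ 1`. -/
theorem one_le_of_term_le (hW0 : ∀ x x', 0 ≤ W x x') (hW : ∀ x x', w ≤ W x x')
    (hw : 0 < w) {m : ℕ} (hm : 1 ≤ w ^ 3 * m) {u v : α → ℝ} (hu : ∀ x, 0 ≤ u x)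
    (hv : ∀ x, 0 ≤ v x) {x₁ x₂ : α} (h : 1 + w * (w / 2) ≤ u x₁ * v x₂) :
    1 ≤ ∑ x, ∑ x', W x x' * (u x ^ (2 * m) * v x' ^ (2 * m)) := by
  have hn : ∀ x x', 0 ≤ W x x' * (u x ^ (2 * m) * v x' ^ (2 * m)) := fun x x' =>
    mul_nonneg (hW0 x x') (mul_nonneg (pow_nonneg (hu x) _) (pow_nonneg (hv x') _))
  have h1 : W x₁ x₂ * (u x₁ ^ (2 * m) * v x₂ ^ (2 * m))
      ≤ ∑ x, ∑ x', W x x' * (u x ^ (2 * m) * v x' ^ (2 * m)) :=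
    (Finset.single_le_sum (f := fun x' => W x₁ x' * (u x₁ ^ (2 * m) * v x' ^ (2 * m)))
      (fun x' _ => hn x₁ x') (Finset.mem_univ x₂)).trans
    (Finset.single_le_sum (f := fun x => ∑ x', W x x' * (u x ^ (2 * m) * v x' ^ (2 * m)))
      (fun x _ => Finset.sum_nonneg fun x' _ => hn x x') (Finset.mem_univ x₁))
  refine le_trans ?_ h1
  rw [← mul_pow]
  have hb : 1 + (2 * m : ℕ) * (w * (w / 2)) ≤ (1 + w * (w / 2)) ^ (2 * m) :=
    one_add_mul_le_pow (by nlinarith [mul_pos hw hw]) _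
  have hb2 : (1 + w * (w / 2)) ^ (2 * m) ≤ (u x₁ * v x₂) ^ (2 * m) :=
    pow_le_pow_left₀ (by positivity) h _
  have h3 : w * (1 + (2 * m : ℕ) * (w * (w / 2))) ≤ W x₁ x₂ * (u x₁ * v x₂) ^ (2 * m) :=
    mul_le_mul (hW _ _) (hb.trans hb2) (by positivity) (hW0 _ _)
  refine le_trans ?_ h3
  push_cast
  nlinarith

/-- Reverse hypercontractivity of a strictly positive coupling of `μ` with itself. -/
theorem exists_reverse_hypercontractive (hμ1 : ∑ x, μ x = 1)
    (hr : ∀ x, ∑ x', W x x' = μ x) (hc : ∀ x', ∑ x, W x x' = μ x')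
    (hW : ∀ x x', 0 < W x x') :
    ∃ r : ℕ, 1 ≤ r ∧ ∀ u v : α → ℝ, (∀ x, 0 ≤ u x) → (∀ x, 0 ≤ v x) →
      (∑ x, μ x * u x) ^ r * (∑ x, μ x * v x) ^ r ≤ ∑ x, ∑ x', W x x' * (u x ^ r * v x' ^ r) := by
  have hne : Nonempty α := by
    by_contra hc
    rw [not_nonempty_iff] at hc
    simp at hμ1
  obtain ⟨z, hz⟩ := Finite.exists_min (fun z : α × α => W z.1 z.2)
  set w := W z.1 z.2 with hwdef
  have hw : 0 < w := hW _ _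
  have hwW : ∀ x x', w ≤ W x x' := fun x x' => hz (x, x')
  have hwμ : ∀ x, w ≤ μ x := fun x => by
    rw [← hr x]
    exact (hwW x x).trans
      (Finset.single_le_sum (fun x' _ => (hW x x').le) (Finset.mem_univ x))
  have hμ0 : ∀ x, 0 < μ x := fun x => hw.trans_le (hwμ x)
  have hμle : ∀ x, μ x ≤ 1 := fun x => by
    rw [← hμ1]
    exact Finset.single_le_sum (fun x' _ => (hμ0 x').le) (Finset.mem_univ x)
  have hw1 : w ≤ 1 := (hwμ z.1).trans (hμle _)
  have hWμ : ∀ x x', w * (μ x * μ x') ≤ W x x' := fun x x' =>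
    (mul_le_of_le_one_right hw.le (mul_le_one₀ (hμle x) (hμ0 x').le (hμle x'))).trans (hwW x x')
  obtain ⟨m, hm⟩ := exists_nat_ge (1 / w ^ 3)
  rw [div_le_iff₀ (by positivity)] at hm
  have hm3 : 1 ≤ w ^ 3 * m := by linarith
  have hm1 : 1 ≤ w * m := by
    have : w ^ 3 * m ≤ w * m := mul_le_mul_of_nonneg_right
      (pow_le_of_le_one hw.le hw1 (by norm_num)) (Nat.cast_nonneg _)
    linarith
  have hmpos : 1 ≤ m := by
    rcases Nat.eq_zero_or_pos m with h | h
    · simp [h] at hm1; linarith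
    · exact h
  -- By homogeneity both means may be taken equal to 1. Either both functions stay above `1 - w /
  -- 2`, or one dips below and so exceeds `1 + w ^ 2 / 2` somewhere, while the other is at least 1
  -- somewhere.
  have norm : ∀ u v : α → ℝ, (∀ x, 0 ≤ u x) → (∀ x, 0 ≤ v x) → ∑ x, μ x * u x = 1 →
      ∑ x, μ x * v x = 1 → 1 ≤ ∑ x, ∑ x', W x x' * (u x ^ (2 * m) * v x' ^ (2 * m)) := by
    intro u v hu hv hu1 hv1
    by_cases h1 : ∀ x, 1 - w / 2 ≤ u x
    · by_cases h2 : ∀ x, 1 - w / 2 ≤ v x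
      · exact coupling_moment_of_near_one (fun x => (hμ0 x).le) hμ1 hr hc hw hw1 hWμ hm1 h1 h2
          hu1 hv1
      · push Not at h2
        obtain ⟨x₀, hx₀⟩ := h2
        obtain ⟨x₂, hx₂⟩ := exists_one_add_le_of_lt (fun x => (hμ0 x).le) hμ1 hv1 hwμ hw
          (half_pos hw) hx₀
        obtain ⟨x₁, hx₁⟩ := exists_one_le hμ1 hμ0 hu1
        exact one_le_of_term_le (fun x x' => (hW x x').le) hwW hw hm3 hu hv
          (hx₂.trans (le_mul_of_one_le_left (hv _) hx₁))
    · push Not at h1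
      obtain ⟨x₀, hx₀⟩ := h1
      obtain ⟨x₁, hx₁⟩ := exists_one_add_le_of_lt (fun x => (hμ0 x).le) hμ1 hu1 hwμ hw
        (half_pos hw) hx₀
      obtain ⟨x₂, hx₂⟩ := exists_one_le hμ1 hμ0 hv1
      exact one_le_of_term_le (fun x x' => (hW x x').le) hwW hw hm3 hu hv
        (hx₁.trans (le_mul_of_one_le_right (hu _) hx₂))
  refine ⟨2 * m, by omega, fun u v hu hv => ?_⟩
  have hU : 0 ≤ ∑ x, μ x * u x := Finset.sum_nonneg fun x _ => mul_nonneg (hμ0 x).le (hu x)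
  have hV : 0 ≤ ∑ x, μ x * v x := Finset.sum_nonneg fun x _ => mul_nonneg (hμ0 x).le (hv x)
  have hR : 0 ≤ ∑ x, ∑ x', W x x' * (u x ^ (2 * m) * v x' ^ (2 * m)) :=
    Finset.sum_nonneg fun x _ => Finset.sum_nonneg fun x' _ =>
      mul_nonneg (hW x x').le (mul_nonneg (pow_nonneg (hu x) _) (pow_nonneg (hv x') _))
  have hne0 : 2 * m ≠ 0 := by omega
  rcases hU.eq_or_lt with hU0 | hU0
  · simpa [← hU0, zero_pow hne0] using hR
  rcases hV.eq_or_lt with hV0 | hV0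
  · simpa [← hV0, zero_pow hne0] using hR
  set U := ∑ x, μ x * u x
  set V := ∑ x, μ x * v x
  have := norm (fun x => u x / U) (fun x => v x / V) (fun x => div_nonneg (hu x) hU)
    (fun x => div_nonneg (hv x) hV)
    (by simp_rw [mul_div_assoc', ← Finset.sum_div]; exact div_self hU0.ne')
    (by simp_rw [mul_div_assoc', ← Finset.sum_div]; exact div_self hV0.ne')
  have e : ∀ x x', W x x' * ((u x / U) ^ (2 * m) * (v x' / V) ^ (2 * m))
      = W x x' * (u x ^ (2 * m) * v x' ^ (2 * m)) / (U ^ (2 * m) * V ^ (2 * m)) := fun x x' => by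
    rw [div_pow, div_pow]; field_simp
  simp_rw [e, ← Finset.sum_div] at this
  rwa [le_div_iff₀ (by positivity), one_mul] at this

theorem sum_fin_succ_fun {γ : Type*} [AddCommMonoid γ] {n : ℕ} (F : (Fin (n + 1) → α) → γ) :
    ∑ x, F x = ∑ a, ∑ x : Fin n → α, F (Fin.cons a x) := by
  rw [← Fintype.sum_prod_type']
  exact (Fintype.sum_equiv (Fin.consEquiv fun _ => α) _ _ fun _ => rfl).symm

/-- Two-function reverse hypercontractive inequalities tensorize. -/
theorem reverse_hypercontractive_pi (hμ : ∀ x, 0 ≤ μ x) (hW : ∀ x x', 0 ≤ W x x') {r : ℕ}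
    (h : ∀ u v : α → ℝ, (∀ x, 0 ≤ u x) → (∀ x, 0 ≤ v x) →
      (∑ x, μ x * u x) ^ r * (∑ x, μ x * v x) ^ r ≤ ∑ x, ∑ x', W x x' * (u x ^ r * v x' ^ r))
    (n : ℕ) (u v : (Fin n → α) → ℝ) (hu : ∀ x, 0 ≤ u x) (hv : ∀ x, 0 ≤ v x) :
    (∑ x, (∏ j, μ (x j)) * u x) ^ r * (∑ x, (∏ j, μ (x j)) * v x) ^ r
      ≤ ∑ x, ∑ x', (∏ j, W (x j) (x' j)) * (u x ^ r * v x' ^ r) := by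
  induction n with
  | zero => simp
  | succ n ih =>
    have hP : ∀ x : Fin n → α, 0 ≤ ∏ j, μ (x j) := fun x => Finset.prod_nonneg fun j _ => hμ _
    have e : ∀ f : (Fin (n + 1) → α) → ℝ, ∑ x, (∏ j, μ (x j)) * f x
        = ∑ a, μ a * ∑ x : Fin n → α, (∏ j, μ (x j)) * f (Fin.cons a x) := fun f => by
      rw [sum_fin_succ_fun]
      simp [Fin.prod_univ_succ, Finset.mul_sum, mul_assoc]
    rw [e, e]
    refine (h _ _ (fun a => Finset.sum_nonneg fun x _ => mul_nonneg (hP x) (hu _))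
      (fun a => Finset.sum_nonneg fun x _ => mul_nonneg (hP x) (hv _))).trans ?_
    -- The one-letter inequality has been applied to the means over the tail as functions of the
    -- first letter. Their `r`-th powers are exactly what the induction hypothesis bounds.
    calc _ ≤ ∑ a, ∑ a', W a a' * ∑ x : Fin n → α, ∑ x' : Fin n → α, (∏ j, W (x j) (x' j)) *
          (u (Fin.cons a x) ^ r * v (Fin.cons a' x') ^ r) :=
        Finset.sum_le_sum fun a _ => Finset.sum_le_sum fun a' _ =>
          mul_le_mul_of_nonneg_left (ih _ _ (fun x => hu _) (fun x => hv _)) (hW a a')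
      _ = _ := by
        rw [sum_fin_succ_fun]
        refine Finset.sum_congr rfl fun a _ => ?_
        simp_rw [sum_fin_succ_fun (α := α) (n := n) (γ := ℝ), Fin.prod_univ_succ, Fin.cons_zero,
          Fin.cons_succ]
        rw [Finset.sum_comm]
        simp_rw [Finset.mul_sum, mul_assoc]

end Coupling

/-! ### Product laws and the entropy converse -/

theorem sum_prod_fun {α : Type*} [Fintype α] {n : ℕ} (g : Fin n → α → ℝ) :
    ∑ x : Fin n → α, ∏ j, g j (x j) = ∏ j, ∑ a, g j a := by
  classical
  rw [Finset.prod_univ_sum, Fintype.piFinset_univ]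

/-- Under a product law, the expectation of a function of one coordinate. -/
theorem sum_prod_mul_coord {α : Type*} [Fintype α] {μ : α → ℝ} (hμ1 : ∑ a, μ a = 1) {n : ℕ}
    (φ : α → ℝ) (i : Fin n) :
    ∑ x : Fin n → α, (∏ j, μ (x j)) * φ (x i) = ∑ a, μ a * φ a := by
  classical
  have e : ∀ x : Fin n → α, (∏ j, μ (x j)) * φ (x i)
      = ∏ j, (μ (x j) * if j = i then φ (x j) else 1) := fun x => by
    rw [Finset.prod_mul_distrib]
    simp
  simp_rw [e, sum_prod_fun (fun j a => μ a * if j = i then φ a else 1)]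
  rw [Finset.prod_eq_single i]
  · simp
  · intro j _ hj
    simp [hj, hμ1]
  · simp

/-- Gibbs' inequality. -/
theorem sum_mul_log_le {ι : Type*} [Fintype ι] {P Q : ι → ℝ} (hP : ∀ x, 0 < P x)
    (hQ : ∀ x, 0 < Q x) (h : ∑ x, Q x ≤ ∑ x, P x) :
    ∑ x, P x * Real.log (Q x) ≤ ∑ x, P x * Real.log (P x) := by
  have key : ∑ x, (P x * Real.log (Q x) - P x * Real.log (P x)) ≤ ∑ x, (Q x - P x) :=
    Finset.sum_le_sum fun x _ => by
      have h1 := Real.log_le_sub_one_of_pos (div_pos (hQ x) (hP x))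
      rw [Real.log_div (hQ x).ne' (hP x).ne'] at h1
      have h2 := mul_le_mul_of_nonneg_left h1 (hP x).le
      have h3 : P x * (Q x / P x - 1) = Q x - P x := by
        have := (hP x).ne'
        field_simp
      linarith
  simp_rw [Finset.sum_sub_distrib] at key
  linarith

section Converse

variable {α : Type*} [Fintype α] {μ : α → ℝ}

/-- If `k` code bits describe `n` independent letters, conditional letter models given the code
bits pay, in total, at least the entropy of the letters minus the `k` bits. -/
theorem sum_log_model_le (hμ : ∀ a, 0 < μ a) (hμ1 : ∑ a, μ a = 1) {n k : ℕ}
    (enc : (Fin n → α) → Fin k → Bool) (q : Fin n → (Fin k → Bool) → α → ℝ)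
    (hq : ∀ i c a, 0 < q i c a) (hq1 : ∀ i c, ∑ a, q i c a ≤ 1) :
    ∑ i, ∑ x, (∏ j, μ (x j)) * Real.log (q i (enc x) (x i))
      ≤ k * Real.log 2 + n * ∑ a, μ a * Real.log (μ a) := by
  have hP : ∀ x : Fin n → α, 0 < ∏ j, μ (x j) := fun x => Finset.prod_pos fun j _ => hμ _
  have hP1 : ∑ x : Fin n → α, ∏ j, μ (x j) = 1 := by
    rw [sum_prod_fun (fun _ => μ)]
    simp [hμ1]
  have hq0 : ∀ x, 0 < ∏ j, q j (enc x) (x j) := fun x => Finset.prod_pos fun j _ => hq _ _ _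
  -- The comparison measure draws a uniform codeword and then independent letters from the models.
  -- Keeping only the codeword `enc x` leaves total mass at most 1, so Gibbs' inequality applies.
  have hQ : ∑ x : Fin n → α, ((1 / 2 : ℝ) ^ k * ∏ j, q j (enc x) (x j)) ≤ 1 := by
    calc ∑ x : Fin n → α, ((1 / 2 : ℝ) ^ k * ∏ j, q j (enc x) (x j))
        ≤ ∑ x : Fin n → α, ∑ c, ((1 / 2 : ℝ) ^ k * ∏ j, q j c (x j)) :=
          Finset.sum_le_sum fun x _ =>
            Finset.single_le_sum (f := fun c => (1 / 2 : ℝ) ^ k * ∏ j, q j c (x j))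
              (fun c _ => mul_nonneg (by positivity)
                (Finset.prod_nonneg fun j _ => (hq _ _ _).le)) (Finset.mem_univ (enc x))
      _ = ∑ c, (1 / 2 : ℝ) ^ k * ∏ j, ∑ a, q j c a := by
          rw [Finset.sum_comm]
          exact Finset.sum_congr rfl fun c _ => by
            rw [← Finset.mul_sum, sum_prod_fun (fun j => q j c)]
      _ ≤ ∑ c : Fin k → Bool, (1 / 2 : ℝ) ^ k :=
          Finset.sum_le_sum fun c _ => mul_le_of_le_one_right (by positivity)
            (Finset.prod_le_one (fun j _ => Finset.sum_nonneg fun a _ => (hq _ _ _).le)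
              fun j _ => hq1 j c)
      _ = 1 := by simp
  have key := sum_mul_log_le hP (fun x => mul_pos (by positivity) (hq0 x)) (hQ.trans hP1.ge)
  have e1 : ∀ x : Fin n → α, Real.log ((1 / 2 : ℝ) ^ k * ∏ j, q j (enc x) (x j))
      = -(k * Real.log 2) + ∑ j, Real.log (q j (enc x) (x j)) := fun x => by
    rw [Real.log_mul (by positivity) (hq0 x).ne', Real.log_pow,
      Real.log_prod fun j _ => (hq _ _ _).ne', one_div, Real.log_inv]
    ring
  have e2 : ∀ x : Fin n → α, Real.log (∏ j, μ (x j)) = ∑ j, Real.log (μ (x j)) := fun x =>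
    Real.log_prod fun j _ => (hμ _).ne'
  simp_rw [e1, e2, mul_add, Finset.sum_add_distrib, ← Finset.sum_mul, hP1, Finset.mul_sum] at key
  rw [Finset.sum_comm, Finset.sum_comm (t := (Finset.univ : Finset (Fin n)))] at key
  simp_rw [sum_prod_mul_coord hμ1 (fun a => Real.log (μ a))] at key
  simp only [Finset.sum_const, Finset.card_univ, Fintype.card_fin, nsmul_eq_mul] at key
  linarith

open Classical in
/-- Below entropy, some letter is predicted with error bounded below by every predictor that sees
the whole codeword. -/
theorem exists_prediction_error_lower_bound (hμ : ∀ a, 0 < μ a) (hμ1 : ∑ a, μ a = 1) {R : ℝ}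
    (hR : R * Real.log 2 < -∑ a, μ a * Real.log (μ a)) :
    ∃ η : ℝ, 0 < η ∧ ∀ n k : ℕ, 1 ≤ n → (k : ℝ) ≤ n * R → ∀ enc : (Fin n → α) → Fin k → Bool,
      ∃ i, ∀ f : (Fin k → Bool) → α,
        η ≤ ∑ x, (∏ j, μ (x j)) * if f (enc x) = x i then 0 else 1 := by
  set H := ∑ a, μ a * Real.log (μ a)
  -- Half of the entropy gap per letter, in nats: one half pays for correct predictions, the other
  -- for errors.
  obtain ⟨g, hg⟩ : ∃ g, g = (-H - R * Real.log 2) / 2 := ⟨_, rfl⟩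
  have hg0 : 0 < g := by rw [hg]; linarith
  have hne : Nonempty α := by
    by_contra hc
    rw [not_nonempty_iff] at hc
    simp at hμ1
  set N := (Fintype.card α : ℝ)
  have hN : 1 ≤ N := Nat.one_le_cast.2 Fintype.card_pos
  set s := 1 - Real.exp (-g) with hs
  have hs0 : 0 < s := by
    have : Real.exp (-g) < 1 := by
      rw [← Real.exp_zero]
      exact Real.exp_lt_exp.2 (by linarith)
    linarith
  have hs1 : s < 1 := by linarith [Real.exp_pos (-g)]
  have hsN : 0 < s / N := by positivity
  have hsN1 : s / N < 1 := by rw [div_lt_one (by linarith)]; linarith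
  set L := -Real.log (s / N) with hL
  have hL0 : 0 < L := by linarith [Real.log_neg hsN hsN1]
  refine ⟨g / L, by positivity, fun n k hn hk enc => ?_⟩
  by_contra! hcon
  choose f hf using hcon
  -- Each predictor is smoothed into a letter model. A correct prediction costs `-log (1 - s) = g`
  -- and a wrong one `L`, so error probability below `g / L` keeps the expected cost per letter
  -- under `2 * g`, contradicting the converse.
  set q : Fin n → (Fin k → Bool) → α → ℝ := fun i c a => if f i c = a then 1 - s else s / N
  have hq : ∀ i c a, 0 < q i c a := fun i c a => by
    simp only [q]
    split_ifs <;> linarith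
  have hq1 : ∀ i c, ∑ a, q i c a ≤ 1 := fun i c => by
    calc ∑ a, q i c a ≤ ∑ a, ((if f i c = a then 1 - s else 0) + s / N) :=
          Finset.sum_le_sum fun a _ => by
            simp only [q]
            split_ifs <;> linarith
      _ = 1 := by
          rw [Finset.sum_add_distrib]
          simp only [Finset.sum_ite_eq, Finset.mem_univ, if_true, Finset.sum_const,
            Finset.card_univ, nsmul_eq_mul]
          rw [mul_div_cancel₀ _ (by linarith : N ≠ 0)]
          ring
  have key := sum_log_model_le hμ hμ1 enc q hq hq1
  have hlog : ∀ i x, -g - L * (if f i (enc x) = x i then 0 else 1)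
      ≤ Real.log (q i (enc x) (x i)) := fun i x => by
    simp only [q]
    split_ifs
    · simp [hs]
    · rw [hL]; linarith
  have hP : ∀ x : Fin n → α, 0 ≤ ∏ j, μ (x j) := fun x => Finset.prod_nonneg fun j _ => (hμ _).le
  have hP1 : ∑ x : Fin n → α, ∏ j, μ (x j) = 1 := by
    rw [sum_prod_fun (fun _ => μ)]
    simp [hμ1]
  have hi : ∀ i, -(2 * g) < ∑ x, (∏ j, μ (x j)) * Real.log (q i (enc x) (x i)) := fun i => by
    have h1 : ∑ x, (∏ j, μ (x j)) * (-g - L * (if f i (enc x) = x i then 0 else 1))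
        ≤ ∑ x, (∏ j, μ (x j)) * Real.log (q i (enc x) (x i)) :=
      Finset.sum_le_sum fun x _ => mul_le_mul_of_nonneg_left (hlog i x) (hP x)
    simp_rw [mul_sub, Finset.sum_sub_distrib, ← Finset.sum_mul, hP1, mul_left_comm _ L,
      ← Finset.mul_sum] at h1
    have h2 := hf i
    rw [lt_div_iff₀ hL0] at h2
    linarith
  have hn0 : Nonempty (Fin n) := ⟨⟨0, hn⟩⟩
  have hsum := Finset.sum_lt_sum_of_nonempty Finset.univ_nonempty fun i _ => hi i
  simp only [Finset.sum_const, Finset.card_univ, Fintype.card_fin, nsmul_eq_mul] at hsum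
  have hk2 : (k : ℝ) * Real.log 2 ≤ n * R * Real.log 2 :=
    mul_le_mul_of_nonneg_right hk (Real.log_nonneg (by norm_num))
  rw [hg] at hsum
  linarith

end Converse

/-! ### Confusion through the side information -/

section Confusion

variable {α β : Type*} [Fintype α] [Fintype β] {J : α → β → ℝ}

/-- For a confusable source, two sets of `x`-sequences produce common `y`-sequences with
probability polynomial in their own probabilities. -/
theorem exists_confusion_lower_bound (hJ : ∀ a b, 0 ≤ J a b) (hJ1 : ∑ a, ∑ b, J a b = 1)
    (hconf : ∀ a a', ∃ b, 0 < J a b ∧ 0 < J a' b) :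
    ∃ r : ℕ, 1 ≤ r ∧ ∀ (n : ℕ) (A B : Set (Fin n → α)),
      (∑ x, (∏ j, ∑ b, J (x j) b) * A.indicator 1 x) ^ r *
        (∑ x, (∏ j, ∑ b, J (x j) b) * B.indicator 1 x) ^ r ≤
      ∑ y : Fin n → β, (∑ x, (∏ j, J (x j) (y j)) * A.indicator 1 x) *
        (∑ x, (∏ j, J (x j) (y j)) * B.indicator 1 x) / ∏ j, ∑ a, J a (y j) := by
  -- The joint law of two inputs that are conditionally independent given the same output.
  -- Confusability is exactly its strict positivity.
  set W : α → α → ℝ := fun a a' => ∑ b, J a b * J a' b / ∑ z, J z b with hW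
  have hm : ∀ b, 0 ≤ ∑ z, J z b := fun b => Finset.sum_nonneg fun z _ => hJ z b
  have hle : ∀ a b, J a b ≤ ∑ z, J z b := fun a b =>
    Finset.single_le_sum (f := fun z => J z b) (fun z _ => hJ z b) (Finset.mem_univ a)
  have hr : ∀ a, ∑ a', W a a' = ∑ b, J a b := fun a => by
    simp only [hW]
    rw [Finset.sum_comm]
    refine Finset.sum_congr rfl fun b _ => ?_
    rw [← Finset.sum_div, ← Finset.mul_sum]
    rcases (hm b).eq_or_lt with h | h
    · rw [← h, mul_zero, zero_div]
      exact le_antisymm (hJ a b) ((hle a b).trans h.ge)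
    · exact mul_div_cancel_right₀ _ h.ne'
  have hsymm : ∀ a a', W a a' = W a' a := fun a a' => by simp only [hW, mul_comm]
  have hterm : ∀ a a' b, 0 ≤ J a b * J a' b / ∑ z, J z b := fun a a' b =>
    div_nonneg (mul_nonneg (hJ a b) (hJ a' b)) (hm b)
  have hWpos : ∀ a a', 0 < W a a' := fun a a' => by
    obtain ⟨b, h1, h2⟩ := hconf a a'
    exact Finset.sum_pos' (fun b _ => hterm a a' b)
      ⟨b, Finset.mem_univ b, div_pos (mul_pos h1 h2) (h1.trans_le (hle a b))⟩
  obtain ⟨r, hr1, h⟩ := exists_reverse_hypercontractive hJ1 hr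
    (fun a' => by simp_rw [hsymm _ a', hr]) hWpos
  refine ⟨r, hr1, fun n A B => ?_⟩
  have ind : ∀ (A : Set (Fin n → α)) x, (0 : ℝ) ≤ A.indicator 1 x := fun A x =>
    Set.indicator_nonneg (fun _ _ => zero_le_one) x
  -- Indicators are unchanged by the power `r`, as `r ≥ 1`; this turns the functional inequality
  -- into one about sets.
  have indr : ∀ (A : Set (Fin n → α)) x,
      (A.indicator 1 x : ℝ) ^ r = A.indicator 1 x := fun A x => by
    by_cases h : x ∈ A
    · simp [h]
    · simpa [h] using (by omega : r ≠ 0)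
  refine (reverse_hypercontractive_pi (fun a => Finset.sum_nonneg fun b _ => hJ a b)
    (fun a a' => (hWpos a a').le) h n _ _ (ind A) (ind B)).trans (le_of_eq ?_)
  have e : ∀ x x' : Fin n → α, ∏ j, W (x j) (x' j)
      = ∑ y : Fin n → β, (∏ j, J (x j) (y j)) * (∏ j, J (x' j) (y j)) / ∏ j, ∑ a, J a (y j) :=
    fun x x' => by
      simp only [hW]
      rw [← sum_prod_fun (fun j b => J (x j) b * J (x' j) b / ∑ z, J z b)]
      simp_rw [Finset.prod_div_distrib, Finset.prod_mul_distrib]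
  simp_rw [indr, e, Finset.sum_mul_sum, Finset.sum_div, Finset.sum_mul]
  symm
  rw [Finset.sum_comm]
  refine Finset.sum_congr rfl fun x _ => ?_
  rw [Finset.sum_comm]
  refine Finset.sum_congr rfl fun x' _ => Finset.sum_congr rfl fun y _ => ?_
  ring

end Confusion

/-! ### From confusion to estimation error -/

section Confusion

variable {α β γ : Type*} [Fintype α] [Fintype β] {J : α → β → ℝ} {n : ℕ}

/-- An estimator that sees only `f X^n` and `Y^n` errs whenever it resolves a confusion between two
letters wrongly. -/
theorem confusion_le_error (hJ : ∀ a b, 0 ≤ J a b) (f : (Fin n → α) → γ) (i : Fin n) (c : γ)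
    {a b : α} (hab : a ≠ b) (q : γ → (Fin n → β) → α → ℝ) (hq1 : ∀ c y a, q c y a ≤ 1)
    (hq : ∀ y, q c y a + q c y b ≤ 1) :
    ∑ y : Fin n → β,
        (∑ x, (∏ j, J (x j) (y j)) * {x | f x = c ∧ x i = a}.indicator 1 x) *
        (∑ x, (∏ j, J (x j) (y j)) * {x | f x = c ∧ x i = b}.indicator 1 x) /
          ∏ j, ∑ z, J z (y j)
      ≤ ∑ x, ∑ y, (∏ j, J (x j) (y j)) * (1 - q (f x) y (x i)) := by
  rw [Finset.sum_comm (s := (Finset.univ : Finset (Fin n → α)))]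
  refine Finset.sum_le_sum fun y _ => ?_
  have hP : ∀ x : Fin n → α, 0 ≤ ∏ j, J (x j) (y j) := fun x =>
    Finset.prod_nonneg fun j _ => hJ _ _
  have hT : ∏ j, ∑ z, J z (y j) = ∑ x : Fin n → α, ∏ j, J (x j) (y j) :=
    (sum_prod_fun (fun j z => J z (y j))).symm
  have hT0 : 0 ≤ ∏ j, ∑ z, J z (y j) := hT ▸ Finset.sum_nonneg fun x _ => hP x
  have bound : ∀ A : Set (Fin n → α),
      0 ≤ ∑ x, (∏ j, J (x j) (y j)) * A.indicator 1 x ∧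
      ∑ x, (∏ j, J (x j) (y j)) * A.indicator 1 x ≤ ∏ j, ∑ z, J z (y j) := by
    intro A
    constructor
    · exact Finset.sum_nonneg fun x _ => mul_nonneg (hP x) (Set.indicator_nonneg (fun _ _ => zero_le_one) x)
    · rw [hT]
      exact Finset.sum_le_sum fun x _ =>
        mul_le_of_le_one_right (hP x) (Set.indicator_le_self' (fun _ _ => zero_le_one) x)
  obtain ⟨hs0, hs1⟩ := bound {x | f x = c ∧ x i = a}
  obtain ⟨ht0, ht1⟩ := bound {x | f x = c ∧ x i = b}
  have split : (∑ x, (∏ j, J (x j) (y j)) * {x | f x = c ∧ x i = a}.indicator 1 x) *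
        (1 - q c y a) +
      (∑ x, (∏ j, J (x j) (y j)) * {x | f x = c ∧ x i = b}.indicator 1 x) *
        (1 - q c y b) ≤ ∑ x, (∏ j, J (x j) (y j)) * (1 - q (f x) y (x i)) := by
    rw [Finset.sum_mul, Finset.sum_mul, ← Finset.sum_add_distrib]
    refine Finset.sum_le_sum fun x _ => ?_
    have h0 : 0 ≤ (∏ j, J (x j) (y j)) * (1 - q (f x) y (x i)) :=
      mul_nonneg (hP x) (by linarith [hq1 (f x) y (x i)])
    by_cases hc : f x = c
    · by_cases ha : x i = a
      · simp [hc, ha, hab]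
      · by_cases hb : x i = b
        · simp [hc, hb, hab.symm]
        · simpa [ha, hb] using h0
    · simpa [hc] using h0
  set s := ∑ x, (∏ j, J (x j) (y j)) * {x | f x = c ∧ x i = a}.indicator 1 x
  set t := ∑ x, (∏ j, J (x j) (y j)) * {x | f x = c ∧ x i = b}.indicator 1 x
  set T := ∏ j, ∑ z, J z (y j)
  -- For fixed `y`, the error is at least `min s t`, because the failure probabilities on `a` and
  -- `b` add up to at least 1, and `s * t / T ≤ min s t` as `s, t ≤ T`. When `T = 0` the quotient is
  -- 0 by convention.
  have h1 : s * t / T ≤ s := div_le_of_le_mul₀ hT0 hs0 (mul_le_mul_of_nonneg_left ht1 hs0)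
  have h2 : s * t / T ≤ t := div_le_of_le_mul₀ hT0 ht0 (by
    rw [mul_comm s t]; exact mul_le_mul_of_nonneg_left hs1 ht0)
  have h0 : 0 ≤ s * t / T := div_nonneg (mul_nonneg hs0 ht0) hT0
  have ha := hq1 c y a
  have hb := hq1 c y b
  have h3 := mul_le_mul_of_nonneg_right h1 (by linarith : 0 ≤ 1 - q c y a)
  have h4 := mul_le_mul_of_nonneg_right h2 (by linarith : 0 ≤ 1 - q c y b)
  have h5 := mul_nonneg h0 (by linarith [hq y] : 0 ≤ 1 - q c y a - q c y b)
  linarith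

open Classical in
/-- If no predictor recovers `X_i` from `f X^n`, then some value of `f` is compatible with two
letters, both with large probability. -/
theorem exists_two_likely_letters [Fintype γ] {P : (Fin n → α) → ℝ} [Nonempty α]
    (f : (Fin n → α) → γ) (i : Fin n) {η : ℝ} (hη : 0 < η)
    (h : ∀ g : γ → α, η ≤ ∑ x, P x * if g (f x) = x i then 0 else 1) :
    ∃ (c : γ) (a b : α), a ≠ b ∧
      η / (Fintype.card γ * Fintype.card α)
        ≤ ∑ x, P x * {x | f x = c ∧ x i = a}.indicator 1 x ∧
      η / (Fintype.card γ * Fintype.card α)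
        ≤ ∑ x, P x * {x | f x = c ∧ x i = b}.indicator 1 x := by
  set M : γ → α → ℝ := fun c a => ∑ x, P x * {x | f x = c ∧ x i = a}.indicator 1 x with hM
  -- The maximum a posteriori predictor. Its error is the total mass of the pairs `(c, b)` with `b ≠
  -- g c`, so some such pair carries at least the average, and `g c` is at least as likely as `b`.
  choose g hg using fun c => Finite.exists_max (M c)
  have hγ : Nonempty γ := ⟨f fun _ => Classical.arbitrary α⟩
  have hγ0 : (0 : ℝ) < Fintype.card γ := Nat.cast_pos.2 Fintype.card_pos
  have hα0 : (0 : ℝ) < Fintype.card α := Nat.cast_pos.2 Fintype.card_pos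
  have hsum : ∑ x, P x * (if g (f x) = x i then 0 else 1)
      = ∑ z : γ × α, if g z.1 = z.2 then 0 else M z.1 z.2 := by
    have e : ∀ z : γ × α, (if g z.1 = z.2 then 0 else M z.1 z.2)
        = ∑ x, if z = (f x, x i) then P x * (if g (f x) = x i then 0 else 1) else 0 := by
      rintro ⟨c, a⟩
      simp only [hM, Prod.mk.injEq]
      split_ifs with hc
      · symm
        refine Finset.sum_eq_zero fun x _ => ?_
        split_ifs with h1 h2
        · simp
        · exact absurd (h1.1 ▸ h1.2 ▸ hc) h2
        · rfl
      · refine Finset.sum_congr rfl fun x _ => ?_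
        by_cases h1 : f x = c ∧ x i = a
        · obtain ⟨rfl, rfl⟩ := h1
          simp [hc]
        · have h2 : ¬(c = f x ∧ a = x i) := fun h2 => h1 ⟨h2.1.symm, h2.2.symm⟩
          simp [h1, h2]
    simp_rw [e]
    rw [Finset.sum_comm]
    simp
  have hle : ∑ _z : γ × α, η / (Fintype.card γ * Fintype.card α)
      ≤ ∑ z : γ × α, if g z.1 = z.2 then 0 else M z.1 z.2 := by
    rw [← hsum]
    refine le_trans (le_of_eq ?_) (h g)
    simp only [Finset.sum_const, Finset.card_univ, Fintype.card_prod, nsmul_eq_mul, Nat.cast_mul]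
    field_simp
  obtain ⟨⟨c, b⟩, -, hz⟩ := Finset.exists_le_of_sum_le Finset.univ_nonempty hle
  have hpos : 0 < η / (Fintype.card γ * Fintype.card α) := by positivity
  by_cases hgb : g c = b
  · simp only [hgb, if_true] at hz
    linarith
  · simp only [hgb, if_false] at hz
    exact ⟨c, g c, b, hgb, hz.trans (hg c b), hz⟩

end Confusion

/-! ### Local decoders and the two conclusions -/

variable {α β : Type*} [Fintype α] [Fintype β]

theorem _root_.PMF.sum_toReal {ι : Type*} [Fintype ι] (p : PMF ι) : ∑ a, (p a).toReal = 1 := by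
  have h := p.tsum_coe
  rw [tsum_fintype] at h
  rw [← ENNReal.toReal_sum fun a _ => p.apply_ne_top a, h, ENNReal.toReal_one]

theorem _root_.PMF.toReal_le_one {ι : Type*} (p : PMF ι) (a : ι) : (p a).toReal ≤ 1 :=
  ENNReal.toReal_le_of_le_ofReal zero_le_one (by simpa using p.coe_le_one a)

theorem _root_.PMF.toReal_add_le_one {ι : Type*} (p : PMF ι) {a b : ι} (h : a ≠ b) :
    (p a).toReal + (p b).toReal ≤ 1 := by
  classical
  rw [← ENNReal.toReal_add (p.apply_ne_top a) (p.apply_ne_top b)]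
  refine ENNReal.toReal_le_of_le_ofReal zero_le_one ?_
  rw [ENNReal.ofReal_one, ← p.tsum_coe, ← Finset.sum_pair h]
  exact ENNReal.sum_le_tsum _

/-- Below entropy, some letter cannot be estimated from `d` code bits and `Y^n` with error
probability less than an exponential in `d`, whatever the positions of the bits. -/
theorem exists_local_error_lower_bound (p : PMF (α × β)) (hp : IsConfusable p) {R : ℝ}
    (hR : R < entropyX p) :
    ∃ K : ℝ, 0 < K ∧ ∀ n k d : ℕ, 1 ≤ n → (k : ℝ) ≤ n * R → 1 ≤ d →
      ∀ enc : (Fin n → α) → Fin k → Bool, ∃ i, ∀ S : Finset (Fin k), S.card ≤ d →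
        ∀ q : (S → Bool) → (Fin n → β) → α → ℝ, (∀ c y a, q c y a ≤ 1) →
          (∀ c y a b, a ≠ b → q c y a + q c y b ≤ 1) →
          (2 : ℝ) ^ (-(K * d)) ≤
            ∑ x, ∑ y, iidProb p x y * (1 - q (fun j => enc x j) y (x i)) := by
  set J : α → β → ℝ := fun a b => (p (a, b)).toReal with hJdef
  have hJ : ∀ a b, 0 ≤ J a b := fun a b => ENNReal.toReal_nonneg
  have hJ1 : ∑ a, ∑ b, J a b = 1 := by
    rw [← p.sum_toReal, Fintype.sum_prod_type]
  have hconf : ∀ a a', ∃ b, 0 < J a b ∧ 0 < J a' b := fun a a' => by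
    obtain ⟨b, h1, h2⟩ := hp a a'
    exact ⟨b, ENNReal.toReal_pos h1.ne' (p.apply_ne_top _),
      ENNReal.toReal_pos h2.ne' (p.apply_ne_top _)⟩
  have hμ : ∀ a, 0 < marginalX p a := fun a => by
    obtain ⟨b, h1, -⟩ := hconf a a
    exact Finset.sum_pos' (fun b _ => hJ a b) ⟨b, Finset.mem_univ b, h1⟩
  have hne : Nonempty α := by
    by_contra hc
    rw [not_nonempty_iff] at hc
    simp at hJ1
  have hR' : R * Real.log 2 < -∑ a, marginalX p a * Real.log (marginalX p a) := by
    have hl : 0 < Real.log 2 := Real.log_pos (by norm_num)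
    have := mul_lt_mul_of_pos_right hR hl
    simp only [entropyX, Real.logb, mul_div_assoc', ← Finset.sum_div] at this
    rwa [← neg_div, div_mul_cancel₀ _ hl.ne'] at this
  obtain ⟨η, hη, hpred⟩ := exists_prediction_error_lower_bound hμ hJ1 hR'
  obtain ⟨r, hr1, hsets⟩ := exists_confusion_lower_bound hJ hJ1 hconf
  have hα0 : (0 : ℝ) < Fintype.card α := Nat.cast_pos.2 Fintype.card_pos
  -- `l` absorbs the constant `η / card α` into a power of `1 / 2`. Since `d ≥ 1`, `l + d ≤ (l + 1)
  -- * d`, so the constant joins the exponent; the factor `2 * r` in `K` comes from the two `r`-th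
  -- powers.
  obtain ⟨l, hl⟩ := exists_pow_lt_of_lt_one (div_pos hη hα0) (by norm_num : (1 / 2 : ℝ) < 1)
  refine ⟨(2 * r * (l + 1) : ℕ), by positivity, fun n k d hn hk hd enc => ?_⟩
  obtain ⟨i, hi⟩ := hpred n k hn hk enc
  refine ⟨i, fun S hS q hq1 hq => ?_⟩
  -- A predictor from the bits in `S` is in particular a predictor from the whole codeword.
  obtain ⟨c, a, b, hab, ha, hb⟩ := exists_two_likely_letters
    (fun x (j : S) => enc x j) i hη fun g => hi fun c => g fun j => c j
  refine le_trans ?_ ((hsets n _ _).trans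
    (confusion_le_error hJ (fun x (j : S) => enc x j) i c hab q hq1 fun y => hq c y a b hab))
  have hδ : (1 / 2 : ℝ) ^ ((l + 1) * d)
      ≤ η / (Fintype.card (S → Bool) * Fintype.card α) := by
    have hcard : (Fintype.card (S → Bool) : ℝ) ≤ 2 ^ d := by
      simp only [Fintype.card_fun, Fintype.card_bool, Fintype.card_coe, Nat.cast_pow,
        Nat.cast_ofNat]
      exact pow_le_pow_right₀ (by norm_num) hS
    calc (1 / 2 : ℝ) ^ ((l + 1) * d) ≤ (1 / 2 : ℝ) ^ (l + d) :=
          pow_le_pow_of_le_one (by norm_num) (by norm_num) (by nlinarith)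
      _ = (1 / 2 : ℝ) ^ l / 2 ^ d := by rw [pow_add, one_div_pow 2 d]; ring
      _ ≤ η / Fintype.card α / 2 ^ d := by gcongr
      _ = η / (2 ^ d * Fintype.card α) := by rw [div_div, mul_comm]
      _ ≤ _ := by
        refine div_le_div_of_nonneg_left hη.le ?_ (mul_le_mul_of_nonneg_right hcard hα0.le)
        exact mul_pos (Nat.cast_pos.2 Fintype.card_pos) hα0
  calc (2 : ℝ) ^ (-(((2 * r * (l + 1) : ℕ) : ℝ) * d))
      = ((1 / 2 : ℝ) ^ ((l + 1) * d)) ^ r * ((1 / 2 : ℝ) ^ ((l + 1) * d)) ^ r := by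
        rw [← pow_mul, ← pow_add, ← Nat.cast_mul, Real.rpow_neg (by norm_num), Real.rpow_natCast,
          one_div, inv_pow]
        congr 2
        ring
    _ ≤ _ := mul_le_mul (pow_le_pow_left₀ (by positivity) (hδ.trans ha) r)
        (pow_le_pow_left₀ (by positivity) (hδ.trans hb) r) (by positivity)
        (pow_nonneg ((by positivity : (0 : ℝ) ≤ (1 / 2) ^ ((l + 1) * d)).trans (hδ.trans ha)) r)

/-- A lower bound that holds for every probed set holds for the error probability. -/
theorem le_errorProb (p : PMF (α × β)) {n : ℕ} {κ σ τ : Type*} [Fintype κ]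
    (codeword : (Fin n → α) → (Fin n → β) → κ → Bool)
    (side : (Fin n → α) → (Fin n → β) → σ) (target : α → β → τ)
    (D : LocalDecoder n κ σ τ) (i : Fin n) {ε : ℝ}
    (h : ∀ I ∈ (D.probe i).support, ε ≤ ∑ x, ∑ y, iidProb p x y *
      (1 - (D.estimate i I (fun j => codeword x y j) (side x y) (target (x i) (y i))).toReal)) :
    ε ≤ errorProb p codeword side target D i := by
  have e : errorProb p codeword side target D i = ∑ I : Finset κ, (D.probe i I).toReal *
      ∑ x, ∑ y, iidProb p x y * (1 -
        (D.estimate i I (fun j => codeword x y j) (side x y) (target (x i) (y i))).toReal) := by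
    simp only [errorProb, Finset.mul_sum]
    symm
    rw [Finset.sum_comm]
    refine Finset.sum_congr rfl fun x _ => ?_
    rw [Finset.sum_comm]
    refine Finset.sum_congr rfl fun y _ => Finset.sum_congr rfl fun I _ => ?_
    ring
  rw [e]
  calc ε = ∑ I : Finset κ, (D.probe i I).toReal * ε := by
        rw [← Finset.sum_mul, PMF.sum_toReal, one_mul]
    _ ≤ _ := Finset.sum_le_sum fun I _ => by
        by_cases hI : I ∈ (D.probe i).support
        · exact mul_le_mul_of_nonneg_left (h I hI) ENNReal.toReal_nonneg
        · rw [PMF.mem_support_iff, not_not] at hI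
          simp [hI]

end LocalCompression

theorem theorem2 {α β : Type*} [Fintype α] [Fintype β] (p : PMF (α × β))
    (hp : LocalCompression.IsConfusable p)
    (R₁ : ℝ) (hR₁ : R₁ < LocalCompression.entropyX p) :
    (∃ K : ℝ, 0 < K ∧
      ∀ (n k d : ℕ), 1 ≤ n → (k : ℝ) ≤ n * R₁ → 1 ≤ d →
      ∀ (enc : (Fin n → α) → Fin k → Bool)
        (D : LocalCompression.LocalDecoder n (Fin k) (Fin n → β) α),
        D.ProbesAtMost d →
        (2 : ℝ) ^ (-(K * d)) ≤ LocalCompression.worstErrorX p enc D) ∧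
    ∀ R₂ : ℝ, ¬ LocalCompression.AchievableWithStrongLocality p R₁ R₂ := by
  open LocalCompression in
  constructor
  · obtain ⟨K, hK, h⟩ := exists_local_error_lower_bound p hp hR₁
    refine ⟨K, hK, fun n k d hn hk hd enc D hD => ?_⟩
    obtain ⟨i, hi⟩ := h n k d hn hk hd enc
    refine le_trans ?_ (le_ciSup (Set.finite_range _).bddAbove i)
    exact le_errorProb p _ _ _ D i fun I hI => hi I (hD i I hI)
      (fun c y a => (D.estimate i I c y a).toReal) (fun c y a => PMF.toReal_le_one _ _)
      (fun c y a b hab => PMF.toReal_add_le_one _ hab)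
  · rintro R₂ ⟨k₁, k₂, enc₁, enc₂, D, d, hk₁, -, hD, hlim⟩
    -- The length bound holds only asymptotically, so an intermediate rate leaves room for the
    -- slack.
    obtain ⟨R, hR₁R, hR⟩ := exists_between hR₁
    obtain ⟨K, hK, h⟩ := exists_local_error_lower_bound p hp hR
    -- `d + 1` replaces `d` because the decoder may probe no bit, while the lower bound needs a
    -- positive budget.
    have hsmall := hlim.eventually (gt_mem_nhds
      (Real.rpow_pos_of_pos two_pos (-(K * (d + 1 : ℕ)))))
    obtain ⟨n, hn, hn1, hn2⟩ :=
      (hsmall.and ((hk₁ (R - R₁) (by linarith)).and (eventually_ge_atTop 1))).exists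
    rw [add_sub_cancel] at hn1
    obtain ⟨i, hi⟩ := h n (k₁ n) (d + 1) hn2 hn1 (by omega) (enc₁ n)
    refine hn.not_ge (le_trans ?_ (le_ciSup (Set.finite_range _).bddAbove i))
    refine le_errorProb p _ _ _ (D n) i fun I hI => ?_
    -- The probed bits of the second codeword are functions of `y`, so only those of the first count
    -- against the budget.
    let bits (c : I.toLeft → Bool) (y : Fin n → β) (j : I) : Bool :=
      match j with
      | ⟨.inl l, hl⟩ => c ⟨l, Finset.mem_toLeft.2 hl⟩
      | ⟨.inr l, _⟩ => enc₂ n y l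
    have hb : ∀ x y, (fun j : I => Sum.elim (enc₁ n x) (enc₂ n y) (j : Fin (k₁ n) ⊕ Fin (k₂ n)))
        = bits (fun j => enc₁ n x j) y := fun x y => by
      funext j
      obtain ⟨l | l, hl⟩ := j <;> rfl
    simp only [hb]
    exact hi I.toLeft (Finset.card_toLeft_le.trans ((hD n i I hI).trans (Nat.le_succ d)))
      -- Knowing `y`, the decoder is credited with `a` when it outputs `(a, y i)`; distinct letters
      -- give distinct pairs, so these weights add up to at most 1.
      (fun c y a => ((D n).estimate i I (bits c y) () (a, y i)).toReal)
      (fun c y a => PMF.toReal_le_one _ _)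
      (fun c y a b hab => PMF.toReal_add_le_one _ fun hc => hab (Prod.mk.inj hc).1)
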